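/- Let $R$ be a commutative ring with unity and let $C$ be a semidualizing $R$-module, that is: $C$ has a projective resolution by finitely generated projective modules, the homothety map $R\to\operatorname{Hom}_R(C,C)$ is an isomorphism, and $\operatorname{Ext}^i_R(C,C)=0$ for all $i\ge 1$. An $R$-module $M$ is called $G_C$-projective if there is an exact sequence of $R$-modules $$\mathbb X=\cdots\to P_1\to P_0\to C\otimes_R P_{-1}\to C\otimes_R P_{-2}\to\cdots$$ with all $P_i$ projective, such that $M\cong\operatorname{im}(P_0\to C\otimes_R P_{-1})$ and $\operatorname{Hom}_R(\mathbb X,C\otimes_R P)$ is exact for every projective $R$-module $P$. For an $R$-module $T$, let $\operatorname{add}_R T$ be the class of modules isomorphic to direct summands of finite direct sums of copies of $T$. Let $\operatorname{gen}^*(T)$ be the class of modules $N$ for which there is an exact sequence $\cdots\to T_1\to T_0\to N\to 0$ with all $T_i\in\operatorname{add}_R T$ that stays exact under $\operatorname{Hom}_R(T,-)$; dually, let $\operatorname{cogen}^*(T)$ be the class of modules $N$ for which there is an exact sequence $0\to N\to T^0\to T^1\to\cdots$ with all $T^i\in\operatorname{add}_R T$ that stays exact under $\operatorname{Hom}_R(-,T)$.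 **Lemma.** Let $M$ be a finitely generated $G_C$-projective $R$-module. Then: 1. $M\in\operatorname{cogen}^*(C)$. Moreover, there are integers $\alpha_0,\alpha_1,\ldots\ge 0$ and an exact sequence $0\to M\to C^{\alpha_0}\to C^{\alpha_1}\to\cdots$ that stays exact under $\operatorname{Hom}_R(-,C)$. 2. $M^C:=\operatorname{Hom}_R(M,C)\in\operatorname{gen}^*(R)$. -/

import Mathlib

open scoped TensorProduct

universe u

namespace RelGorenstein

section

variable {R : Type u} [CommRing R]

/-- The sequence `Hom(B'', N) → Hom(B, N) → Hom(B', N)` obtained from `B' → B → B''` by applying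
`Hom(-, N)` is exact at `Hom(B, N)`. -/
def ContraHomExact (N : Type u) [AddCommGroup N] [Module R N]
    {B' B B'' : Type u} [AddCommGroup B'] [Module R B'] [AddCommGroup B] [Module R B]
    [AddCommGroup B''] [Module R B''] (f : B' →ₗ[R] B) (g : B →ₗ[R] B'') : Prop :=
  Function.Exact (fun φ : B'' →ₗ[R] N => φ.comp g) (fun φ : B →ₗ[R] N => φ.comp f)

/-- The sequence `Hom(N, B') → Hom(N, B) → Hom(N, B'')` obtained from `B' → B → B''` by applying
`Hom(N, -)` is exact at `Hom(N, B)`. -/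
def CovHomExact (N : Type u) [AddCommGroup N] [Module R N]
    {B' B B'' : Type u} [AddCommGroup B'] [Module R B'] [AddCommGroup B] [Module R B]
    [AddCommGroup B''] [Module R B''] (f : B' →ₗ[R] B) (g : B →ₗ[R] B'') : Prop :=
  Function.Exact (fun φ : N →ₗ[R] B' => f.comp φ) (fun φ : N →ₗ[R] B => g.comp φ)

/-- An exact sequence `⋯ → X₁ → X₀ → M → 0`. -/
structure Resolution (R : Type u) [CommRing R] (M : Type u) [AddCommGroup M] [Module R M] where
  X : ℕ → ModuleCat.{u} R
  d : ∀ n, X (n + 1) →ₗ[R] X n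
  aug : X 0 →ₗ[R] M
  exact : ∀ n, Function.Exact (d (n + 1)) (d n)
  exact_aug : Function.Exact (d 0) aug
  surjective_aug : Function.Surjective aug

/-- `Hom(T, -)` leaves the augmented sequence `⋯ → X₁ → X₀ → M → 0` exact. -/
structure Resolution.HomExact {M : Type u} [AddCommGroup M] [Module R M] (S : Resolution R M)
    (T : Type u) [AddCommGroup T] [Module R T] : Prop where
  exact : ∀ n, CovHomExact T (S.d (n + 1)) (S.d n)
  exact_aug : CovHomExact T (S.d 0) S.aug
  surjective_aug : Function.Surjective (fun φ : T →ₗ[R] S.X 0 => S.aug.comp φ)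

/-- An exact sequence `0 → M → X⁰ → X¹ → ⋯`. -/
structure Coresolution (R : Type u) [CommRing R] (M : Type u) [AddCommGroup M] [Module R M] where
  X : ℕ → ModuleCat.{u} R
  d : ∀ n, X n →ₗ[R] X (n + 1)
  coaug : M →ₗ[R] X 0
  injective_coaug : Function.Injective coaug
  exact_coaug : Function.Exact coaug (d 0)
  exact : ∀ n, Function.Exact (d n) (d (n + 1))

/-- `Hom(-, T)` leaves the augmented sequence `0 → M → X⁰ → X¹ → ⋯` exact. -/
structure Coresolution.HomExact {M : Type u} [AddCommGroup M] [Module R M] (S : Coresolution R M)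
    (T : Type u) [AddCommGroup T] [Module R T] : Prop where
  surjective_coaug : Function.Surjective (fun φ : S.X 0 →ₗ[R] T => φ.comp S.coaug)
  exact_coaug : ContraHomExact T S.coaug (S.d 0)
  exact : ∀ n, ContraHomExact T (S.d n) (S.d (n + 1))

/-- `X` lies in `add T`: it is isomorphic to a direct summand of a finite direct sum of copies
of `T`. -/
def IsInAdd (R : Type u) [CommRing R] (T : Type u) [AddCommGroup T] [Module R T]
    (X : Type u) [AddCommGroup X] [Module R X] : Prop :=
  ∃ (n : ℕ) (p q : Submodule R (Fin n → T)), IsCompl p q ∧ Nonempty (X ≃ₗ[R] p)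

/-- `M` lies in `gen*(T)`. -/
def IsInGenStar (R : Type u) [CommRing R] (T : Type u) [AddCommGroup T] [Module R T]
    (M : Type u) [AddCommGroup M] [Module R M] : Prop :=
  ∃ S : Resolution R M, (∀ n, IsInAdd R T (S.X n)) ∧ S.HomExact T

/-- `M` lies in `cogen*(T)`. -/
def IsInCogenStar (R : Type u) [CommRing R] (T : Type u) [AddCommGroup T] [Module R T]
    (M : Type u) [AddCommGroup M] [Module R M] : Prop :=
  ∃ S : Coresolution R M, (∀ n, IsInAdd R T (S.X n)) ∧ S.HomExact T

/-- `C` is a semidualizing `R`-module. -/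
structure IsSemidualizing (R : Type u) [CommRing R] (C : Type u) [AddCommGroup C] [Module R C] :
    Prop where
  /-- `C` has a projective resolution by finitely generated projective modules. -/
  resolution : ∃ S : Resolution R C, ∀ n, Module.Finite R (S.X n) ∧ Module.Projective R (S.X n)
  /-- The homothety map `R → Hom(C, C)`, `r ↦ (c ↦ r • c)`, is an isomorphism. -/
  homothety : Function.Bijective (LinearMap.lsmul R C)
  /-- `Extⁱ(C, C) = 0` for `i ≥ 1`. -/
  ext_eq_zero : ∀ i : ℕ, 1 ≤ i →
    Subsingleton (CategoryTheory.Abelian.Ext (ModuleCat.of R C) (ModuleCat.of R C) i)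

/-- An exact sequence `⋯ → P₁ → P₀ → C ⊗ Q₀ → C ⊗ Q₁ → ⋯` with all `Pₙ`, `Qₙ` projective
(`Qₙ` is the module with index `-(n + 1)`) which stays exact under `Hom(-, C ⊗ P)` for every
projective module `P`. -/
structure CompleteResolution (R : Type u) [CommRing R] (C : Type u) [AddCommGroup C]
    [Module R C] where
  P : ℕ → ModuleCat.{u} R
  Q : ℕ → ModuleCat.{u} R
  projective_P : ∀ n, Module.Projective R (P n)
  projective_Q : ∀ n, Module.Projective R (Q n)
  dP : ∀ n, P (n + 1) →ₗ[R] P n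
  mid : P 0 →ₗ[R] C ⊗[R] Q 0
  dQ : ∀ n, C ⊗[R] Q n →ₗ[R] C ⊗[R] Q (n + 1)
  exact_P : ∀ n, Function.Exact (dP (n + 1)) (dP n)
  exact_P_mid : Function.Exact (dP 0) mid
  exact_mid_Q : Function.Exact mid (dQ 0)
  exact_Q : ∀ n, Function.Exact (dQ n) (dQ (n + 1))
  homExact_P : ∀ (L : Type u) [AddCommGroup L] [Module R L] [Module.Projective R L] (n : ℕ),
    ContraHomExact (C ⊗[R] L) (dP (n + 1)) (dP n)
  homExact_P_mid : ∀ (L : Type u) [AddCommGroup L] [Module R L] [Module.Projective R L],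
    ContraHomExact (C ⊗[R] L) (dP 0) mid
  homExact_mid_Q : ∀ (L : Type u) [AddCommGroup L] [Module R L] [Module.Projective R L],
    ContraHomExact (C ⊗[R] L) mid (dQ 0)
  homExact_Q : ∀ (L : Type u) [AddCommGroup L] [Module R L] [Module.Projective R L] (n : ℕ),
    ContraHomExact (C ⊗[R] L) (dQ n) (dQ (n + 1))

/-- `M` is `G_C`-projective. -/
def IsGCProjective (R : Type u) [CommRing R] (C : Type u) [AddCommGroup C] [Module R C]
    (M : Type u) [AddCommGroup M] [Module R M] : Prop :=
  ∃ X : CompleteResolution R C, Nonempty (M ≃ₗ[R] LinearMap.range X.mid)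

end

end RelGorenstein

/-! The right half of a complete resolution coresolves `M` by modules `C ⊗ Q`, which are summands of
possibly infinite sums of copies of `C`. The task is to replace them by finite powers of `C`.

Take `0 → X → T → Y → 0` from such a coresolution, with `X` finitely generated. Then `X → T` factors
through some `D = C^n`, and `X → D` inherits injectivity and the extension property. The cokernel `N
= D / X` is finitely generated, and iteration only requires that `N` be coresolved again
(`IsCoresolved.of_cokernels`). The pushout `E` of `D ← X → T` lies in sequences `0 → D → E → Y → 0`
and `0 → T → E → N → 0`. Both split because `Ext¹(Y, D)` and `Ext¹(N, T)` vanish, so `E` is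
coresolved along with `Y`, and `N` inherits this as a complement of `T` in `E`. The vanishing comes
from `Ext¹(C, C) = 0`, extended to infinite sums by finiteness of the first syzygy of `C`.

Dualising the finite coresolution and using `Hom(C, C) ≅ R` gives the second claim. -/

namespace RelGorenstein

/-! ### Elementary forms of `Ext¹` vanishing: lifting and extending maps. -/

section Extensions

variable {R : Type u} [CommRing R]

/-- Every map `X → Z` lifts along every surjection `E → Z` with kernel `L`; this is a form of
`Ext¹(X, L) = 0`. -/
def Lifts (R : Type u) [CommRing R] (X L : Type u) [AddCommGroup X] [Module R X]
    [AddCommGroup L] [Module R L] : Prop :=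
  ∀ ⦃E Z : Type u⦄ [AddCommGroup E] [Module R E] [AddCommGroup Z] [Module R Z]
    (ι : L →ₗ[R] E) (g : E →ₗ[R] Z), Function.Injective ι → Function.Exact ι g →
    Function.Surjective g → ∀ h : X →ₗ[R] Z, ∃ h' : X →ₗ[R] E, g ∘ₗ h' = h

/-- Every map `A → L` extends along `f : A → B`. -/
def Extends {A B : Type u} [AddCommGroup A] [Module R A] [AddCommGroup B] [Module R B]
    (f : A →ₗ[R] B) (L : Type u) [AddCommGroup L] [Module R L] : Prop :=
  ∀ φ : A →ₗ[R] L, ∃ ψ : B →ₗ[R] L, ψ ∘ₗ f = φ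

variable {A B X L Y : Type u} [AddCommGroup A] [Module R A] [AddCommGroup B] [Module R B]
  [AddCommGroup X] [Module R X] [AddCommGroup L] [Module R L] [AddCommGroup Y] [Module R Y]

theorem exists_factor_of_exact {f : A →ₗ[R] B} {g : B →ₗ[R] X} (hf : Function.Injective f)
    (hfg : Function.Exact f g) (φ : Y →ₗ[R] B) (h : g ∘ₗ φ = 0) :
    ∃ ψ : Y →ₗ[R] A, f ∘ₗ ψ = φ := by
  have hr : ∀ y, φ y ∈ LinearMap.range f := fun y => (hfg (φ y)).1 (LinearMap.congr_fun h y)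
  refine ⟨(LinearEquiv.ofInjective f hf).symm.toLinearMap ∘ₗ φ.codRestrict _ hr, ?_⟩
  ext y
  simp

theorem exists_desc_of_exact {f : A →ₗ[R] B} {g : B →ₗ[R] X} (hfg : Function.Exact f g)
    (hg : Function.Surjective g) (φ : B →ₗ[R] Y) (h : φ ∘ₗ f = 0) :
    ∃ ψ : X →ₗ[R] Y, ψ ∘ₗ g = φ := by
  have hk : LinearMap.ker g ≤ LinearMap.ker φ := by
    intro b hb
    obtain ⟨a, rfl⟩ := (hfg b).1 hb
    exact LinearMap.congr_fun h a
  refine ⟨(LinearMap.ker g).liftQ φ hk ∘ₗ (g.quotKerEquivOfSurjective hg).symm.toLinearMap, ?_⟩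
  ext b
  have : (g.quotKerEquivOfSurjective hg).symm (g b) = (LinearMap.ker g).mkQ b := by
    rw [LinearEquiv.symm_apply_eq]
    rfl
  simp [this]

/-- The pushout of two linear maps. -/
theorem exists_pushout (f : A →ₗ[R] B) (φ : A →ₗ[R] L) :
    ∃ (E : ModuleCat.{u} R) (ι : L →ₗ[R] E) (κ : B →ₗ[R] E), κ ∘ₗ f = ι ∘ₗ φ ∧
      (∀ e, ∃ l b, e = ι l + κ b) ∧
      (∀ l b, ι l + κ b = 0 → ∃ a, l = φ a ∧ b = -f a) ∧
      ∀ (W : Type u) [AddCommGroup W] [Module R W] (v : L →ₗ[R] W) (w : B →ₗ[R] W),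
        w ∘ₗ f = v ∘ₗ φ → ∃ q : E →ₗ[R] W, q ∘ₗ ι = v ∧ q ∘ₗ κ = w := by
  let N := LinearMap.range (φ.prod (-f))
  refine ⟨ModuleCat.of R ((L × B) ⧸ N), N.mkQ ∘ₗ LinearMap.inl R L B,
    N.mkQ ∘ₗ LinearMap.inr R L B, ?_, ?_, ?_, ?_⟩
  · ext a
    refine (Submodule.Quotient.eq N).2 ⟨-a, ?_⟩
    simp
  · intro e
    obtain ⟨⟨l, b⟩, rfl⟩ := N.mkQ_surjective e
    refine ⟨l, b, ?_⟩
    simp only [LinearMap.comp_apply]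
    rw [← map_add]
    simp
  · intro l b h
    simp only [LinearMap.comp_apply] at h
    rw [← map_add] at h
    obtain ⟨a, ha⟩ := (Submodule.Quotient.mk_eq_zero N).1 h
    simp only [LinearMap.inl_apply, LinearMap.inr_apply, Prod.mk_add_mk, add_zero, zero_add] at ha
    exact ⟨a, (congrArg Prod.fst ha).symm, (congrArg Prod.snd ha).symm⟩
  · intro W _ _ v w h
    refine ⟨N.liftQ (v.coprod w) ?_, ?_, ?_⟩
    · rintro _ ⟨a, rfl⟩
      have := LinearMap.congr_fun h a
      simp only [LinearMap.comp_apply] at this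
      simp [this]
    · ext l
      change v l + w 0 = v l
      rw [map_zero, add_zero]
    · ext b
      change v 0 + w b = w b
      rw [map_zero, zero_add]

/-- Pushing `0 → A → B → X → 0` out along `φ` gives an extension of `X` by `L`; its splitting yields
the extension of `φ`. -/
theorem Lifts.extends (hX : Lifts R X L) {f : A →ₗ[R] B} {g : B →ₗ[R] X}
    (hf : Function.Injective f) (hfg : Function.Exact f g) (hg : Function.Surjective g) :
    Extends f L := by
  intro φ
  obtain ⟨E, ι, κ, hκ, hsum, hzero, hdesc⟩ := exists_pushout f φ
  obtain ⟨q, hqι, hqκ⟩ := hdesc X 0 g (by rw [hfg.linearMap_comp_eq_zero, LinearMap.zero_comp])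
  have hι : Function.Injective ι := by
    rw [injective_iff_map_eq_zero]
    intro l hl
    obtain ⟨a, rfl, ha⟩ := hzero l 0 (by simpa using hl)
    have : a = 0 := hf (by simpa using ha.symm)
    simp [this]
  have hex : Function.Exact ι q := by
    intro e
    constructor
    · intro he
      obtain ⟨l, b, rfl⟩ := hsum e
      have hb : g b = 0 := by
        rw [map_add, ← LinearMap.comp_apply, ← LinearMap.comp_apply, hqι, hqκ] at he
        simpa using he
      obtain ⟨a, rfl⟩ := (hfg b).1 hb
      exact ⟨l + φ a, by rw [map_add]; congr 1; exact (LinearMap.congr_fun hκ a).symm⟩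
    · rintro ⟨l, rfl⟩
      exact LinearMap.congr_fun hqι l
  have hqs : Function.Surjective q := fun x => by
    obtain ⟨b, rfl⟩ := hg x
    exact ⟨κ b, LinearMap.congr_fun hqκ b⟩
  obtain ⟨s, hs⟩ := hX ι q hι hex hqs LinearMap.id
  -- With `s` a section of `q`, the difference `κ - s ∘ₗ g` is killed by `q`, so it takes values in
  -- `L`.
  obtain ⟨ψ, hψ⟩ := exists_factor_of_exact hι hex (κ - s ∘ₗ g) (by
    rw [LinearMap.comp_sub, ← LinearMap.comp_assoc, hs, hqκ, LinearMap.id_comp, sub_self])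
  refine ⟨ψ, LinearMap.ext fun a => hι ?_⟩
  have h1 := LinearMap.congr_fun hψ (f a)
  have h2 := LinearMap.congr_fun hκ a
  have h3 := hfg.apply_apply_eq_zero a
  simp only [LinearMap.comp_apply, LinearMap.sub_apply] at h1 h2 ⊢
  rw [h1, h3, h2, map_zero, sub_zero]

/-- Lift on `B` first. The obstruction to descending to `X` is a map `A → L`; extending it to `B`
and subtracting removes it. -/
theorem Lifts.of_extends (hB : Lifts R B L) {f : A →ₗ[R] B} {g : B →ₗ[R] X}
    (hfg : Function.Exact f g) (hg : Function.Surjective g)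
    (hext : Extends f L) : Lifts R X L := by
  intro E Z _ _ _ _ ι q hι hex hq h
  obtain ⟨ψ, hψ⟩ := hB ι q hι hex hq (h ∘ₗ g)
  obtain ⟨φ, hφ⟩ := exists_factor_of_exact hι hex (ψ ∘ₗ f) (by
    rw [← LinearMap.comp_assoc, hψ, LinearMap.comp_assoc, hfg.linearMap_comp_eq_zero,
      LinearMap.comp_zero])
  obtain ⟨θ, hθ⟩ := hext φ
  obtain ⟨h', hh'⟩ := exists_desc_of_exact hfg hg (ψ - ι ∘ₗ θ) (by
    rw [LinearMap.sub_comp, LinearMap.comp_assoc, hθ, hφ, sub_self])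
  refine ⟨h', LinearMap.ext fun x => ?_⟩
  obtain ⟨b, rfl⟩ := hg x
  have h1 := LinearMap.congr_fun hh' b
  have h2 := LinearMap.congr_fun hψ b
  simp only [LinearMap.comp_apply, LinearMap.sub_apply] at h1 h2 ⊢
  rw [h1, map_sub, h2, hex.apply_apply_eq_zero, sub_zero]

theorem Lifts.of_projective [Module.Projective R X] : Lifts R X L :=
  fun _ _ _ _ _ _ _ g _ _ hg h => Module.projective_lifting_property g h hg

theorem Lifts.of_retract (hX : Lifts R X L) {s : Y →ₗ[R] X} {r : X →ₗ[R] Y}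
    (hrs : r ∘ₗ s = LinearMap.id) : Lifts R Y L := by
  intro E Z _ _ _ _ ι q hι hex hq h
  obtain ⟨h', hh'⟩ := hX ι q hι hex hq (h ∘ₗ r)
  exact ⟨h' ∘ₗ s, by
    rw [← LinearMap.comp_assoc, hh', LinearMap.comp_assoc, hrs, LinearMap.comp_id]⟩

theorem Lifts.finsupp (hX : Lifts R X L) (J : Type u) : Lifts R (J →₀ X) L := by
  intro E Z _ _ _ _ ι q hι hex hq h
  choose h' hh' using fun j => hX ι q hι hex hq (h ∘ₗ Finsupp.lsingle j)
  refine ⟨Finsupp.lsum R h', Finsupp.lhom_ext' fun j => ?_⟩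
  rw [← hh' j]
  ext x
  simp

theorem Extends.of_retract {f : A →ₗ[R] B} (hf : Extends f L) {s : Y →ₗ[R] L} {r : L →ₗ[R] Y}
    (hrs : r ∘ₗ s = LinearMap.id) : Extends f Y := by
  intro φ
  obtain ⟨ψ, hψ⟩ := hf (s ∘ₗ φ)
  exact ⟨r ∘ₗ ψ, by
    rw [LinearMap.comp_assoc, hψ, ← LinearMap.comp_assoc, hrs, LinearMap.id_comp]⟩

theorem Extends.comp {f : A →ₗ[R] B} {g : B →ₗ[R] X} (hf : Extends f L) (hg : Extends g L) :
    Extends (g ∘ₗ f) L := by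
  intro φ
  obtain ⟨ψ, rfl⟩ := hf φ
  obtain ⟨θ, rfl⟩ := hg ψ
  exact ⟨θ, rfl⟩

/-- Vanishing of `Ext¹` in the category of modules gives the lifting property. -/
theorem lifts_of_subsingleton_ext
    [Subsingleton (CategoryTheory.Abelian.Ext (ModuleCat.of R X) (ModuleCat.of R L) 1)] :
    Lifts R X L := by
  intro E Z _ _ _ _ ι q hι hex hq h
  let S : CategoryTheory.ShortComplex (ModuleCat.{u} R) :=
    ⟨ModuleCat.ofHom ι, ModuleCat.ofHom q, by
      rw [← ModuleCat.ofHom_comp, hex.linearMap_comp_eq_zero]; rfl⟩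
  have hS : S.ShortExact :=
    { exact := (CategoryTheory.ShortComplex.ShortExact.moduleCat_exact_iff_function_exact S).2 hex
      mono_f := (ModuleCat.mono_iff_injective _).2 hι
      epi_g := (ModuleCat.epi_iff_surjective _).2 hq }
  obtain ⟨x, hx⟩ := CategoryTheory.Abelian.Ext.covariant_sequence_exact₃ (ModuleCat.of R X) hS
    (CategoryTheory.Abelian.Ext.mk₀ (ModuleCat.ofHom h)) (zero_add 1) (Subsingleton.elim _ _)
  obtain ⟨y, rfl⟩ := (CategoryTheory.Abelian.Ext.mk₀_bijective _ _).2 x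
  rw [CategoryTheory.Abelian.Ext.mk₀_comp_mk₀] at hx
  have := (CategoryTheory.Abelian.Ext.mk₀_bijective _ _).1 hx
  exact ⟨y.hom, congrArg ModuleCat.Hom.hom this⟩

end Extensions

/-! ### Summands of arbitrary direct sums of copies of `C`, and `Ext¹` between them. -/

section BigAdd

variable {R : Type u} [CommRing R]

/-- `T` is a direct summand of a (possibly infinite) direct sum of copies of `C`. -/
def IsInBigAdd (R : Type u) [CommRing R] (C : Type u) [AddCommGroup C] [Module R C]
    (T : Type u) [AddCommGroup T] [Module R T] : Prop :=
  ∃ (J : Type u) (s : T →ₗ[R] (J →₀ C)) (r : (J →₀ C) →ₗ[R] T), r ∘ₗ s = LinearMap.id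

variable {C T T' X : Type u} [AddCommGroup C] [Module R C] [AddCommGroup T] [Module R T]
  [AddCommGroup T'] [Module R T'] [AddCommGroup X] [Module R X]

theorem IsInBigAdd.prod (hT : IsInBigAdd R C T) (hT' : IsInBigAdd R C T') :
    IsInBigAdd R C (T × T') := by
  obtain ⟨J, s, r, h⟩ := hT
  obtain ⟨J', s', r', h'⟩ := hT'
  let e := Finsupp.sumFinsuppLEquivProdFinsupp R (M := C) (α := J) (β := J')
  refine ⟨J ⊕ J', e.symm.toLinearMap ∘ₗ s.prodMap s', r.prodMap r' ∘ₗ e.toLinearMap, ?_⟩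
  refine LinearMap.ext fun x => ?_
  have h1 := LinearMap.congr_fun h x.1
  have h2 := LinearMap.congr_fun h' x.2
  simp only [LinearMap.comp_apply, LinearEquiv.coe_coe, LinearEquiv.apply_symm_apply,
    LinearMap.prodMap_apply, LinearMap.id_apply] at h1 h2 ⊢
  rw [h1, h2]

theorem isInBigAdd_pi (n : ℕ) : IsInBigAdd R C (Fin n → C) := by
  let e : (ULift.{u} (Fin n) →₀ C) ≃ₗ[R] (Fin n → C) :=
    (Finsupp.linearEquivFunOnFinite R C _).trans (LinearEquiv.funCongrLeft R C Equiv.ulift.symm)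
  exact ⟨_, e.symm.toLinearMap, e.toLinearMap, by ext; simp⟩

theorem isInBigAdd_tensorProduct (Q : Type u) [AddCommGroup Q] [Module R Q]
    [Module.Projective R Q] : IsInBigAdd R C (C ⊗[R] Q) := by
  classical
  obtain ⟨s, hs⟩ := Module.projective_def'.1 ‹Module.Projective R Q›
  let e := TensorProduct.finsuppScalarRight R R C Q
  refine ⟨Q, e.toLinearMap ∘ₗ s.lTensor C,
    (Finsupp.linearCombination R id).lTensor C ∘ₗ e.symm.toLinearMap, ?_⟩
  refine LinearMap.ext fun x => ?_
  simp only [LinearMap.comp_apply, LinearEquiv.coe_coe, LinearEquiv.symm_apply_apply]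
  rw [← LinearMap.comp_apply, ← LinearMap.lTensor_comp, hs, LinearMap.lTensor_id]

theorem Extends.of_tensorProduct {A B : Type u} [AddCommGroup A] [Module R A] [AddCommGroup B]
    [Module R B] {f : A →ₗ[R] B}
    (hf : ∀ (L : Type u) [AddCommGroup L] [Module R L] [Module.Projective R L],
      Extends f (C ⊗[R] L)) (hT : IsInBigAdd R C T) : Extends f T := by
  classical
  obtain ⟨J, s, r, h⟩ := hT
  let e := TensorProduct.finsuppScalarRight R R C J
  refine ((hf (J →₀ R)).of_retract (s := e.symm.toLinearMap) (r := e.toLinearMap) ?_).of_retract h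
  ext; simp

/-- The images of finitely many generators have finite joint support. -/
theorem exists_factor_pi [Module.Finite R X] {J : Type u} (f : X →ₗ[R] (J →₀ C)) :
    ∃ (n : ℕ) (j : X →ₗ[R] (Fin n → C)) (e : (Fin n → C) →ₗ[R] (J →₀ C)), e ∘ₗ j = f := by
  classical
  obtain ⟨G, hG⟩ := ‹Module.Finite R X›.fg_top
  let S : Finset J := G.biUnion fun x => (f x).support
  have hS : ∀ x, (f x).support ⊆ S := by
    have : (⊤ : Submodule R X) ≤ (Finsupp.supported C R (S : Set J)).comap f := by
      rw [← hG, Submodule.span_le]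
      intro x hx
      simp only [Submodule.comap_coe, Set.mem_preimage, SetLike.mem_coe, Finsupp.mem_supported,
        Finset.coe_subset]
      exact Finset.subset_biUnion_of_mem (fun x => (f x).support) hx
    intro x
    have := this (Submodule.mem_top (x := x))
    simpa [Finsupp.mem_supported] using this
  let a : Fin S.card → J := fun k => (S.equivFin.symm k : J)
  refine ⟨S.card, LinearMap.pi fun k => Finsupp.lapply (a k) ∘ₗ f,
    LinearMap.lsum R _ R fun k => Finsupp.lsingle (a k), LinearMap.ext fun x => ?_⟩
  have h1 : ∑ k, Finsupp.single (a k) (f x (a k)) = ∑ s ∈ S, Finsupp.single s (f x s) := by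
    rw [← Finset.sum_coe_sort S fun s => Finsupp.single s (f x s)]
    exact Equiv.sum_comp S.equivFin.symm fun s : S => Finsupp.single (s : J) (f x s)
  have h2 : (f x).sum Finsupp.single = ∑ s ∈ S, Finsupp.single s (f x s) :=
    Finsupp.sum_of_support_subset _ (hS x) _ (by simp)
  rw [Finsupp.sum_single] at h2
  rw [h2, ← h1]
  simp [LinearMap.lsum_apply]

theorem IsSemidualizing.lifts_self (hC : IsSemidualizing R C) : Lifts R C C :=
  have := hC.ext_eq_zero 1 le_rfl
  lifts_of_subsingleton_ext

/-- The first syzygy `K` of `C` is finitely generated, so a map `K → C^(J)` factors through a finite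
power and extends coordinatewise. -/
theorem IsSemidualizing.lifts_finsupp (hC : IsSemidualizing R C) (J : Type u) :
    Lifts R C (J →₀ C) := by
  obtain ⟨S, hS⟩ := hC.resolution
  have := (hS 0).2
  have := (hS 1).1
  let K := LinearMap.ker S.aug
  have hK : Module.Finite R K := by
    have h : K = LinearMap.range (S.d 0) := S.exact_aug.linearMap_ker_eq
    rw [Module.Finite.iff_fg, h, LinearMap.range_eq_map]
    exact (Module.Finite.fg_top).map _
  have hex : Function.Exact K.subtype S.aug := S.aug.exact_subtype_ker_map
  have hext : Extends K.subtype C :=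
    hC.lifts_self.extends K.injective_subtype hex S.surjective_aug
  refine Lifts.of_extends (Lifts.of_projective (X := S.X 0)) hex S.surjective_aug fun φ => ?_
  obtain ⟨n, j, e, rfl⟩ := exists_factor_pi φ
  choose ψ hψ using fun k => hext (LinearMap.proj k ∘ₗ j)
  refine ⟨e ∘ₗ LinearMap.pi ψ, ?_⟩
  rw [LinearMap.comp_assoc]
  congr 1
  ext x k
  exact LinearMap.congr_fun (hψ k) x

theorem IsSemidualizing.lifts (hC : IsSemidualizing R C) (hT : IsInBigAdd R C T)
    (hT' : IsInBigAdd R C T') : Lifts R T T' := by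
  obtain ⟨J, s, r, h⟩ := hT
  obtain ⟨J', s', r', h'⟩ := hT'
  refine Lifts.of_retract (Lifts.finsupp ?_ J) h
  obtain ⟨S, hS⟩ := hC.resolution
  have := (hS 0).2
  have hex := S.aug.exact_subtype_ker_map
  -- Passing to a summand of the target is immediate for extension problems, hence the detour
  -- through the syzygy.
  exact Lifts.of_extends (Lifts.of_projective (X := S.X 0)) hex S.surjective_aug
    (((hC.lifts_finsupp J').extends (Submodule.injective_subtype _) hex
      S.surjective_aug).of_retract h')

end BigAdd

/-! ### Coresolutions by summands of sums of `C`, and passage to finite powers. -/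

section Coresolved

variable {R : Type u} [CommRing R] {C : Type u} [AddCommGroup C] [Module R C]

/-- There is an exact sequence `0 → X → T → Y → 0` with `T` in the class of direct summands of
direct sums of copies of `C`, exact under `Hom(-, L)` for all `L` in this class. -/
def Step (R : Type u) [CommRing R] (C : Type u) [AddCommGroup C] [Module R C]
    (X Y : Type u) [AddCommGroup X] [Module R X] [AddCommGroup Y] [Module R Y] : Prop :=
  ∃ (T : ModuleCat.{u} R) (i : X →ₗ[R] T) (p : T →ₗ[R] Y), IsInBigAdd R C T ∧
    Function.Injective i ∧ Function.Exact i p ∧ Function.Surjective p ∧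
    ∀ (L : Type u) [AddCommGroup L] [Module R L], IsInBigAdd R C L → Extends i L

/-- `X` admits an infinite coresolution made of steps. -/
def IsCoresolved (R : Type u) [CommRing R] (C : Type u) [AddCommGroup C] [Module R C]
    (X : Type u) [AddCommGroup X] [Module R X] : Prop :=
  ∃ P : ModuleCat.{u} R → Prop, P (ModuleCat.of R X) ∧
    ∀ Z, P Z → ∃ W, P W ∧ Step R C Z W

variable {X Y K N : Type u} [AddCommGroup X] [Module R X] [AddCommGroup Y] [Module R Y]
  [AddCommGroup K] [Module R K] [AddCommGroup N] [Module R N]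

/-- `IsCoresolved` is a coinductive predicate, so it suffices to enlarge the witnessing class by
`X`. -/
theorem IsCoresolved.of_step (hY : IsCoresolved R C Y) (h : Step R C X Y) :
    IsCoresolved R C X := by
  obtain ⟨P, hP, hstep⟩ := hY
  refine ⟨fun Z => Z = ModuleCat.of R X ∨ P Z, Or.inl rfl, ?_⟩
  rintro Z (rfl | hZ)
  · exact ⟨_, Or.inr hP, h⟩
  · obtain ⟨W, hW, hs⟩ := hstep Z hZ
    exact ⟨W, Or.inr hW, hs⟩

theorem IsCoresolved.exists_step (hX : IsCoresolved R C X) :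
    ∃ Y : ModuleCat.{u} R, IsCoresolved R C Y ∧ Step R C X Y := by
  obtain ⟨P, hP, hstep⟩ := hX
  obtain ⟨Y, hY, hs⟩ := hstep _ hP
  exact ⟨Y, ⟨P, hY, hstep⟩, hs⟩

theorem Step.lifts (hC : IsSemidualizing R C) (h : Step R C X Y) {L : Type u} [AddCommGroup L]
    [Module R L] (hL : IsInBigAdd R C L) : Lifts R Y L := by
  obtain ⟨T, i, p, hT, -, hip, hp, hext⟩ := h
  exact (hC.lifts hT hL).of_extends hip hp (hext L hL)

/-- Extensions of coresolved modules by direct summands of sums of copies of `C`. -/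
theorem IsCoresolved.of_extension {T : Type u} [AddCommGroup T] [Module R T]
    (hT : IsInBigAdd R C T) (hY : IsCoresolved R C Y) (hYT : Lifts R Y T)
    {ι : T →ₗ[R] K} {g : K →ₗ[R] Y} (hι : Function.Injective ι) (hex : Function.Exact ι g)
    (hg : Function.Surjective g) : IsCoresolved R C K := by
  obtain ⟨Y', hY', T', i, p, hT', hi, hip, hp, hext⟩ := hY.exists_step
  -- The retraction `ρ` splits `K` as `T ⊕ Y`, so `K` embeds in `T × T'` with the same cokernel `Y'`
  -- as `Y` in `T'`.
  obtain ⟨ρ, hρ⟩ := hYT.extends hι hex hg LinearMap.id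
  have hρι : ∀ t, ρ (ι t) = t := LinearMap.congr_fun hρ
  refine hY'.of_step ⟨ModuleCat.of R (T × T'), ρ.prod (i ∘ₗ g), p ∘ₗ LinearMap.snd R T T',
    hT.prod hT', ?_, ?_, ?_, ?_⟩
  · rw [injective_iff_map_eq_zero]
    intro k hk
    have h1 : ρ k = 0 := congrArg Prod.fst hk
    have h2 : i (g k) = 0 := congrArg Prod.snd hk
    obtain ⟨t, rfl⟩ := (hex k).1 (hi (by rw [h2, map_zero]))
    rw [hρι] at h1
    rw [h1, map_zero]
  · rintro ⟨t, t'⟩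
    constructor
    · intro h
      obtain ⟨y, hy⟩ := (hip t').1 h
      obtain ⟨k, rfl⟩ := hg y
      refine ⟨k + ι (t - ρ k), Prod.ext ?_ ?_⟩
      · change ρ (k + ι (t - ρ k)) = t
        rw [map_add, hρι]
        abel
      · change i (g (k + ι (t - ρ k))) = t'
        rw [map_add, hex.apply_apply_eq_zero, add_zero, hy]
    · rintro ⟨k, hk⟩
      rw [← hk]
      exact hip.apply_apply_eq_zero (g k)
  · intro y
    obtain ⟨t', rfl⟩ := hp y
    exact ⟨(0, t'), rfl⟩
  · intro L _ _ hL φ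
    obtain ⟨χ, hχ⟩ := exists_desc_of_exact hex hg (φ - φ ∘ₗ ι ∘ₗ ρ) (by
      ext t; simp [hρι])
    obtain ⟨ψ, hψ⟩ := hext L hL χ
    refine ⟨(φ ∘ₗ ι).coprod ψ, LinearMap.ext fun k => ?_⟩
    have h1 := LinearMap.congr_fun hψ (g k)
    have h2 := LinearMap.congr_fun hχ k
    simp only [LinearMap.comp_apply, LinearMap.sub_apply] at h1 h2
    change φ (ι (ρ k)) + ψ (i (g k)) = φ k
    rw [h1, h2]
    abel

/-- If `X` embeds into `T` and into `D`, both direct summands of sums of copies of `C`, and `T / X`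
is coresolved, then so is `D / X`. -/
theorem IsCoresolved.of_cokernels (hC : IsSemidualizing R C) (hY : IsCoresolved R C Y)
    {T D : Type u} [AddCommGroup T] [Module R T] [AddCommGroup D] [Module R D]
    (hT : IsInBigAdd R C T) (hD : IsInBigAdd R C D)
    {i : X →ₗ[R] T} {p : T →ₗ[R] Y} {j : X →ₗ[R] D} {q : D →ₗ[R] N}
    (hi : Function.Injective i) (hip : Function.Exact i p) (hp : Function.Surjective p)
    (hj : Function.Injective j) (hjq : Function.Exact j q) (hq : Function.Surjective q)
    (hYD : Lifts R Y D) (hNT : Lifts R N T) : IsCoresolved R C N := by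
  obtain ⟨E, ι, κ, hκ, hsum, hzero, hdesc⟩ := exists_pushout j i
  have hκ' : ∀ x, κ (j x) = ι (i x) := LinearMap.congr_fun hκ
  obtain ⟨a, haι, haκ⟩ := hdesc N 0 q (by rw [hjq.linearMap_comp_eq_zero, LinearMap.zero_comp])
  obtain ⟨b, hbι, hbκ⟩ := hdesc Y p 0 (by rw [hip.linearMap_comp_eq_zero, LinearMap.zero_comp])
  replace haι : ∀ t, a (ι t) = 0 := LinearMap.congr_fun haι
  replace haκ : ∀ d, a (κ d) = q d := LinearMap.congr_fun haκ
  replace hbι : ∀ t, b (ι t) = p t := LinearMap.congr_fun hbι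
  replace hbκ : ∀ d, b (κ d) = 0 := LinearMap.congr_fun hbκ
  have hι : Function.Injective ι := by
    rw [injective_iff_map_eq_zero]
    intro t ht
    obtain ⟨x, rfl, hx⟩ := hzero t 0 (by simpa using ht)
    have : x = 0 := hj (by simpa using hx.symm)
    simp [this]
  have hκi : Function.Injective κ := by
    rw [injective_iff_map_eq_zero]
    intro d hd
    obtain ⟨x, hx, rfl⟩ := hzero 0 d (by simpa using hd)
    have : x = 0 := hi (by simpa using hx.symm)
    simp [this]
  have hιa : Function.Exact ι a := by
    intro e
    constructor
    · intro he
      obtain ⟨t, d, rfl⟩ := hsum e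
      rw [map_add, haι, haκ, zero_add] at he
      obtain ⟨x, rfl⟩ := (hjq d).1 he
      exact ⟨t + i x, by rw [map_add, hκ']⟩
    · rintro ⟨t, rfl⟩
      exact haι t
  have hκb : Function.Exact κ b := by
    intro e
    constructor
    · intro he
      obtain ⟨t, d, rfl⟩ := hsum e
      rw [map_add, hbι, hbκ, add_zero] at he
      obtain ⟨x, rfl⟩ := (hip t).1 he
      exact ⟨j x + d, by rw [map_add, hκ']⟩
    · rintro ⟨t, rfl⟩
      exact hbκ t
  have has : Function.Surjective a := fun n => by
    obtain ⟨d, rfl⟩ := hq n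
    exact ⟨κ d, haκ d⟩
  have hbs : Function.Surjective b := fun y => by
    obtain ⟨t, rfl⟩ := hp y
    exact ⟨ι t, hbι t⟩
  have hE : IsCoresolved R C E := hY.of_extension hD hYD hκi hκb hbs
  -- The section `σ` makes `N` a summand of `E` with complement `T`; composing with a step `E → T'`
  -- embeds `N` in `T'`.
  obtain ⟨σ, hσ⟩ := hNT ι a hι hιa has LinearMap.id
  replace hσ : ∀ n, a (σ n) = n := LinearMap.congr_fun hσ
  obtain ⟨Y', hY', hstep⟩ := hE.exists_step
  have hlift : Lifts R Y' T := hstep.lifts hC hT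
  obtain ⟨T', i', p', hT', hi', hip', hp', hext'⟩ := hstep
  let V := LinearMap.range (i' ∘ₗ σ)
  have hVp : ∀ v ∈ V, p' v = 0 := by
    rintro _ ⟨n, rfl⟩
    exact hip'.apply_apply_eq_zero (σ n)
  -- `T' / N` is an extension of `T' / E = Y'` by `E / N ≅ T`.
  have hV : IsCoresolved R C (T' ⧸ V) := by
    refine hY'.of_extension hT hlift (ι := V.mkQ ∘ₗ i' ∘ₗ ι) (g := V.liftQ p' hVp) ?_ ?_ ?_
    · rw [injective_iff_map_eq_zero]
      intro t ht
      obtain ⟨n, hn⟩ := (Submodule.Quotient.mk_eq_zero V).1 ht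
      have h1 : σ n = ι t := hi' hn
      have h2 : n = 0 := by rw [← hσ n, h1, haι]
      exact hι (by rw [← h1, h2, map_zero, map_zero])
    · intro z
      obtain ⟨t', rfl⟩ := V.mkQ_surjective z
      constructor
      · intro h
        obtain ⟨e, rfl⟩ := (hip' t').1 h
        obtain ⟨t, ht⟩ := (hιa (e - σ (a e))).1 (by rw [map_sub, hσ, sub_self])
        refine ⟨t, (Submodule.Quotient.eq V).2 ⟨-a e, ?_⟩⟩
        simp [ht]
      · rintro ⟨t, ht⟩
        rw [← ht]
        exact hip'.apply_apply_eq_zero (ι t)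
    · intro y
      obtain ⟨t', rfl⟩ := hp' y
      exact ⟨V.mkQ t', rfl⟩
  refine hV.of_step ⟨T', i' ∘ₗ σ, V.mkQ, hT', ?_, ?_, V.mkQ_surjective, ?_⟩
  · exact hi'.comp (Function.LeftInverse.injective hσ)
  · exact LinearMap.exact_map_mkQ_range _
  · intro L _ _ hL
    exact Extends.comp (fun φ => ⟨φ ∘ₗ a, LinearMap.ext fun n => congrArg φ (hσ n)⟩) (hext' L hL)

/-- A finitely generated coresolved module embeds into a finite power of `C` with finitely
generated coresolved cokernel. -/
theorem IsCoresolved.exists_finite_step (hC : IsSemidualizing R C) [Module.Finite R C]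
    [Module.Finite R X] (hX : IsCoresolved R C X) :
    ∃ (N : ModuleCat.{u} R) (n : ℕ) (j : X →ₗ[R] (Fin n → C)) (q : (Fin n → C) →ₗ[R] N),
      (Module.Finite R N ∧ IsCoresolved R C N) ∧ Function.Injective j ∧ Function.Exact j q ∧
      Function.Surjective q ∧ Extends j C := by
  obtain ⟨Y, hY, hstep⟩ := hX.exists_step
  have hYl := fun n => hstep.lifts hC (isInBigAdd_pi (R := R) (C := C) n)
  obtain ⟨T, i, p, hT, hi, hip, hp, hext⟩ := hstep
  obtain ⟨J, s, r, hrs⟩ := id hT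
  -- Since `r ∘ₗ e ∘ₗ j = i`, both injectivity and the extension property pass from `i` to `j`.
  obtain ⟨n, j, e, hej⟩ := exists_factor_pi (s ∘ₗ i)
  have hrej : (r ∘ₗ e) ∘ₗ j = i := by
    rw [LinearMap.comp_assoc, hej, ← LinearMap.comp_assoc, hrs, LinearMap.id_comp]
  have hj : Function.Injective j := by
    refine Function.Injective.of_comp (f := r ∘ₗ e) ?_
    rw [← LinearMap.coe_comp, hrej]
    exact hi
  have hjext : ∀ (L : Type u) [AddCommGroup L] [Module R L], IsInBigAdd R C L → Extends j L := by
    intro L _ _ hL φ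
    obtain ⟨ψ, hψ⟩ := hext L hL φ
    exact ⟨ψ ∘ₗ r ∘ₗ e, by rw [LinearMap.comp_assoc, hrej, hψ]⟩
  have hjq : Function.Exact j (LinearMap.range j).mkQ := LinearMap.exact_map_mkQ_range _
  have hq := (LinearMap.range j).mkQ_surjective
  have hCC : IsInBigAdd R C C :=
    ⟨PUnit, Finsupp.lsingle PUnit.unit, Finsupp.lapply PUnit.unit, by ext; simp⟩
  refine ⟨ModuleCat.of R ((Fin n → C) ⧸ LinearMap.range j), n, j, (LinearMap.range j).mkQ,
    ⟨?_, ?_⟩, hj, hjq, hq, hjext C hCC⟩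
  · exact Module.Finite.of_surjective _ hq
  · exact hY.of_cokernels hC hT (isInBigAdd_pi n) hi hip hp hj hjq hq (hYl n)
      ((hC.lifts (isInBigAdd_pi n) hT).of_extends hjq hq (hjext T hT))

theorem extends_subtype_range {B B' L : Type u} [AddCommGroup B] [Module R B] [AddCommGroup B']
    [Module R B'] [AddCommGroup L] [Module R L] {f : X →ₗ[R] B} {g : B →ₗ[R] B'}
    (hfg : Function.Exact f g) (h : ContraHomExact L f g) :
    Extends (LinearMap.range g).subtype L := by
  intro φ
  obtain ⟨ψ, hψ⟩ := (h (φ ∘ₗ g.rangeRestrict)).1 (by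
    ext x
    have : g.rangeRestrict (f x) = 0 := Subtype.ext (hfg.apply_apply_eq_zero x)
    simp [this])
  refine ⟨ψ, LinearMap.ext ?_⟩
  rintro ⟨_, b, rfl⟩
  exact LinearMap.congr_fun hψ b

theorem IsGCProjective.isCoresolved (hX : IsGCProjective R C X) : IsCoresolved R C X := by
  obtain ⟨S, ⟨e⟩⟩ := hX
  have hQ := S.projective_Q
  -- The witnessing class consists of the syzygies of the right half, each seen as the kernel of
  -- some `S.dQ n`.
  refine ⟨fun Z => ∃ (n : ℕ) (f : Z →ₗ[R] C ⊗[R] S.Q n), Function.Injective f ∧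
    Function.Exact f (S.dQ n) ∧
    ∀ (L : Type u) [AddCommGroup L] [Module R L], IsInBigAdd R C L → Extends f L, ?_, ?_⟩
  · refine ⟨0, (LinearMap.range S.mid).subtype ∘ₗ e.toLinearMap, ?_, ?_, ?_⟩
    · exact (Submodule.injective_subtype _).comp e.injective
    · rw [LinearMap.exact_iff, S.exact_mid_Q.linearMap_ker_eq, LinearMap.range_comp,
        LinearEquiv.range, Submodule.map_top, Submodule.range_subtype]
    · intro L _ _ hL
      refine Extends.comp (fun φ => ⟨φ ∘ₗ e.symm.toLinearMap, by ext; simp⟩) ?_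
      exact Extends.of_tensorProduct (C := C) (fun L _ _ _ =>
        extends_subtype_range S.exact_P_mid (S.homExact_P_mid L)) hL
  · rintro Z ⟨n, f, hf, hfd, hext⟩
    refine ⟨ModuleCat.of R (LinearMap.range (S.dQ n)), ⟨n + 1, (LinearMap.range (S.dQ n)).subtype,
      Submodule.injective_subtype _, ?_, ?_⟩, ModuleCat.of R (C ⊗[R] S.Q n), f,
      (S.dQ n).rangeRestrict, isInBigAdd_tensorProduct _, hf, ?_, ?_, hext⟩
    · rw [LinearMap.exact_iff, (S.exact_Q n).linearMap_ker_eq, Submodule.range_subtype]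
    · intro L _ _ hL
      refine Extends.of_tensorProduct (C := C) (fun L _ _ _ => ?_) hL
      -- The differential entering the source of `S.dQ n` is `S.mid` when `n = 0`.
      cases n with
      | zero => exact extends_subtype_range S.exact_mid_Q (S.homExact_mid_Q L)
      | succ n => exact extends_subtype_range (S.exact_Q n) (S.homExact_Q L n)
    · rw [LinearMap.exact_iff, LinearMap.ker_rangeRestrict, hfd.linearMap_ker_eq]
    · exact LinearMap.surjective_rangeRestrict _

end Coresolved

/-! ### Splicing the finite steps into a coresolution, and dualising it. -/

section Splicing

variable {R : Type u} [CommRing R] {C : Type u} [AddCommGroup C] [Module R C]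

theorem contraHomExact_of_extends {A B D A' D' L : Type u} [AddCommGroup A] [Module R A]
    [AddCommGroup B] [Module R B] [AddCommGroup D] [Module R D] [AddCommGroup D'] [Module R D']
    [AddCommGroup A'] [Module R A'] [AddCommGroup L] [Module R L]
    {f : A →ₗ[R] B} {g : B →ₗ[R] D} (hfg : Function.Exact f g) (hg : Function.Surjective g)
    (s : A' →ₗ[R] A) (hs : Function.Surjective s) {t : D →ₗ[R] D'} (ht : Extends t L) :
    ContraHomExact L (f ∘ₗ s) (t ∘ₗ g) := by
  intro φ
  constructor
  · intro h
    have hφ : φ ∘ₗ f = 0 := by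
      ext a
      obtain ⟨a', rfl⟩ := hs a
      exact LinearMap.congr_fun h a'
    obtain ⟨χ, rfl⟩ := exists_desc_of_exact hfg hg φ hφ
    obtain ⟨ψ, rfl⟩ := ht χ
    exact ⟨ψ, rfl⟩
  · rintro ⟨ψ, rfl⟩
    ext a
    simp [hfg.apply_apply_eq_zero]

theorem exact_splice {A B D A' D' : Type u} [AddCommGroup A] [Module R A]
    [AddCommGroup B] [Module R B] [AddCommGroup D] [Module R D] [AddCommGroup D'] [Module R D']
    [AddCommGroup A'] [Module R A']
    {f : A →ₗ[R] B} {g : B →ₗ[R] D} (hfg : Function.Exact f g)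
    (s : A' →ₗ[R] A) (hs : Function.Surjective s) {t : D →ₗ[R] D'} (ht : Function.Injective t) :
    Function.Exact (f ∘ₗ s) (t ∘ₗ g) := by
  rw [LinearMap.exact_iff, LinearMap.ker_comp, LinearMap.ker_eq_bot.2 ht, LinearMap.range_comp,
    LinearMap.range_eq_top.2 hs, Submodule.map_top, ← hfg.linearMap_ker_eq]
  rfl

theorem exists_coresolution_pi (hC : IsSemidualizing R C) [Module.Finite R C]
    {M : Type u} [AddCommGroup M] [Module R M] [Module.Finite R M] (hM : IsCoresolved R C M) :
    ∃ S : Coresolution R M,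
      (∃ α : ℕ → ℕ, ∀ n, Nonempty (S.X n ≃ₗ[R] (Fin (α n) → C))) ∧ S.HomExact C := by
  -- The cokernels are iterated inside this class, which carries the two properties needed to
  -- continue.
  let 𝒯 := {N : ModuleCat.{u} R // Module.Finite R N ∧ IsCoresolved R C N}
  have key : ∀ X : 𝒯, ∃ (N : 𝒯) (n : ℕ) (j : X.1 →ₗ[R] (Fin n → C))
      (q : (Fin n → C) →ₗ[R] N.1), Function.Injective j ∧ Function.Exact j q ∧
      Function.Surjective q ∧ Extends j C := by
    rintro ⟨X, hX, hX'⟩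
    obtain ⟨N, n, j, q, hN, h⟩ := hX'.exists_finite_step hC
    exact ⟨⟨N, hN⟩, n, j, q, h⟩
  choose next α j q hj hjq hq hext using key
  let N : ℕ → 𝒯 := fun k => Nat.rec ⟨ModuleCat.of R M, ‹_›, hM⟩ (fun _ X => next X) k
  let S : Coresolution R M :=
    { X := fun k => ModuleCat.of R (Fin (α (N k)) → C)
      d := fun k => j (N (k + 1)) ∘ₗ q (N k)
      coaug := j (N 0)
      injective_coaug := hj (N 0)
      exact_coaug := exact_splice (hjq (N 0)) LinearMap.id Function.surjective_id (hj (N 1))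
      exact := fun k => exact_splice (hjq (N (k + 1))) (q (N k)) (hq (N k)) (hj (N (k + 2))) }
  refine ⟨S, ⟨fun k => α (N k), fun k => ⟨LinearEquiv.refl R _⟩⟩, ?_⟩
  exact
    { surjective_coaug := hext (N 0)
      exact_coaug := contraHomExact_of_extends (hjq (N 0)) (hq (N 0)) LinearMap.id
        Function.surjective_id (hext (N 1))
      exact := fun k => contraHomExact_of_extends (hjq (N (k + 1))) (hq (N (k + 1))) (q (N k))
        (hq (N k)) (hext (N (k + 2))) }

theorem isInAdd_of_equiv_pi {T X : Type u} [AddCommGroup T] [Module R T] [AddCommGroup X]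
    [Module R X] {n : ℕ} (e : X ≃ₗ[R] (Fin n → T)) : IsInAdd R T X :=
  ⟨n, ⊤, ⊥, isCompl_top_bot, ⟨e.trans Submodule.topEquiv.symm⟩⟩

theorem covHomExact_of_projective {T B' B B'' : Type u} [AddCommGroup T] [Module R T]
    [Module.Projective R T] [AddCommGroup B'] [Module R B'] [AddCommGroup B] [Module R B]
    [AddCommGroup B''] [Module R B''] {f : B' →ₗ[R] B} {g : B →ₗ[R] B''}
    (hfg : Function.Exact f g) : CovHomExact T f g := by
  intro φ
  constructor
  · intro h
    obtain ⟨φ', hφ'⟩ := exists_factor_of_exact (LinearMap.range f).injective_subtype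
      (g := g) (by rw [LinearMap.exact_iff, hfg.linearMap_ker_eq, Submodule.range_subtype]) φ h
    obtain ⟨ψ, rfl⟩ := Module.projective_lifting_property f.rangeRestrict φ'
      f.surjective_rangeRestrict
    exact ⟨ψ, hφ'⟩
  · rintro ⟨ψ, rfl⟩
    ext t
    simp [hfg.apply_apply_eq_zero]

/-- Dualising a coresolution by finite powers of `C`. -/
theorem Coresolution.isInGenStar_dual (hC : IsSemidualizing R C)
    {M : Type u} [AddCommGroup M] [Module R M] (S : Coresolution R M)
    {α : ℕ → ℕ} (hα : ∀ n, Nonempty (S.X n ≃ₗ[R] (Fin (α n) → C))) (hS : S.HomExact C) :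
    IsInGenStar R R (M →ₗ[R] C) := by
  let D : Resolution R (M →ₗ[R] C) :=
    { X := fun n => ModuleCat.of R (S.X n →ₗ[R] C)
      d := fun n => LinearMap.lcomp R C (S.d n)
      aug := LinearMap.lcomp R C S.coaug
      exact := hS.exact
      exact_aug := hS.exact_coaug
      surjective_aug := hS.surjective_coaug }
  refine ⟨D, fun n => ?_, ?_⟩
  · obtain ⟨e⟩ := hα n
    let h : R ≃ₗ[R] (C →ₗ[R] C) := LinearEquiv.ofBijective (LinearMap.lsmul R C) hC.homothety
    -- `Hom(C^n, C) ≅ Hom(C, C)^n ≅ R^n`, the last by homothety.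
    exact isInAdd_of_equiv_pi (n := α n) (((e.congrLeft C R).trans
      (LinearMap.lsum R (fun _ : Fin (α n) => C) R).symm).trans
      (LinearEquiv.piCongrRight fun _ => h.symm))
  · exact
      { exact := fun n => covHomExact_of_projective (D.exact n)
        exact_aug := covHomExact_of_projective D.exact_aug
        surjective_aug := fun φ => Module.projective_lifting_property D.aug φ D.surjective_aug }

end Splicing

end RelGorenstein

theorem lemma3p1 (R : Type u) [CommRing R]
    (C : Type u) [AddCommGroup C] [Module R C] (hC : RelGorenstein.IsSemidualizing R C)
    (M : Type u) [AddCommGroup M] [Module R M] [Module.Finite R M]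
    (hM : RelGorenstein.IsGCProjective R C M) :
    RelGorenstein.IsInCogenStar R C M ∧
    (∃ S : RelGorenstein.Coresolution R M,
      (∃ α : ℕ → ℕ, ∀ n, Nonempty (S.X n ≃ₗ[R] (Fin (α n) → C))) ∧ S.HomExact C) ∧
    RelGorenstein.IsInGenStar R R (M →ₗ[R] C) := by
  obtain ⟨P, hP⟩ := hC.resolution
  have := (hP 0).1
  have : Module.Finite R C := Module.Finite.of_surjective _ P.surjective_aug
  obtain ⟨S, ⟨α, hα⟩, hS⟩ := RelGorenstein.exists_coresolution_pi hC hM.isCoresolved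
  exact ⟨⟨S, fun n => RelGorenstein.isInAdd_of_equiv_pi (hα n).some, hS⟩, ⟨S, ⟨α, hα⟩, hS⟩,
    S.isInGenStar_dual hC hα hS⟩
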